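/- Let $\pi=(n_1,\ldots,n_m)$, $m\ge 2$, be a partition of $n$, i.e. $n_i\ge1$ and $n_1+\cdots+n_m=n$; it splits every $n\times n$ matrix into blocks $A=(A_{rs})_{r,s=1}^m$ with $A_{rs}$ of size $n_r\times n_s$. Let $\mathcal P_m=\{(i,j): 1\le i<j\le m\}$ and $M=m(m-1)/2$. *Orderings.* $\mathcal B_c^{(m)}$ is the set of orderings of $\mathcal P_m$ of the form $(1,2),(\tau_3(1),3),(\tau_3(2),3),\ldots,(\tau_m(1),m),\ldots,(\tau_m(m-1),m)$, where $\tau_j$ is any permutation of $\{1,\ldots,j-1\}$; $\mathcal B_r^{(m)}$ is the set of orderings of the form $(m-1,m),(m-2,\widetilde\tau_{m-2}(m-1)),(m-2,\widetilde\tau_{m-2}(m)),\ldots,(1,\widetilde\tau_1(2)),\ldots,(1,\widetilde\tau_1(m))$, where $\widetilde\tau_i$ is any permutation of $\{i+1,\ldots,m\}$. The class $\mathcal B_{sp}^{(m)}$ of serial orderings with permutations consists of all elements of $\mathcal B_c^{(m)}\cup\mathcal B_r^{(m)}$ and of all their reverses. *Method.* An orthogonal elementary block matrix with pivot pair $(i,j)$,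 $i<j$, is an orthogonal $n\times n$ matrix $U$ that agrees with the identity outside of the pivot submatrix $\begin{bmatrix}U_{ii}&U_{ij}\\U_{ji}&U_{jj}\end{bmatrix}$. For $0<\varrho\le1$, it belongs to the class $\mathrm{UBC}_\pi(\varrho)$ if $$\sigma_{\min}(U_{ii})=\sigma_{\min}(U_{jj})\ge\varrho\,\gamma_{ij},\qquad \gamma_{ij}=\frac{3}{\sqrt{(4^{n_i}+6n_j-1)(n_j+1)}} .$$ One sweep of the cyclic block Jacobi method with the ordering $\mathcal O=(i_0,j_0),\ldots,(i_{M-1},j_{M-1})$, applied to a symmetric matrix $A$, computes $A^{(0)}=A$, $A^{(k+1)}=U_k^TA^{(k)}U_k$ for $0\le k<M$, and $A'=A^{(M)}$, where $U_k$ is an orthogonal elementary block matrix with pivot pair $(i_k,j_k)$ such that the pivot submatrix of $A^{(k+1)}$, composed of the blocks with indices in $\{i_k,j_k\}$, is diagonal. Put $S(A)=\big(\sum_{s<t}|a_{st}|^2\big)^{1/2}$. **Theorem.** For every $n$ and every $0<\varrho\le1$ there is a constant $\widetilde\eta_{n,\varrho}<1$, depending only on $n$ and $\varrho$, and for every partition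 $\pi=(n_1,\ldots,n_m)$ of $n$ with $m\ge2$ there is a constant $\eta_{\pi,\varrho}$, depending only on $\pi$ and $\varrho$, with $$0\le\eta_{\pi,\varrho}<\widetilde\eta_{n,\varrho}<1,$$ such that the following holds. Let $\mathcal O\in\mathcal B_{sp}^{(m)}$, let $A$ be a real symmetric matrix of order $n$, and let $A'$ be obtained from $A$ by applying one sweep of the cyclic block Jacobi method with the ordering $\mathcal O$, all of whose transformation matrices $U_k$ belong to the class $\mathrm{UBC}_\pi(\varrho)$. Then $$S^2(A')\le\eta_{\pi,\varrho}\,S^2(A).$$ -/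

import Mathlib

namespace BlockJacobi

/-! ### Pivot orderings

Block indices are `0, …, m - 1`. -/

/-- The set of pivot pairs `(i, j)` with `i < j`. -/
def pivotPairs (m : ℕ) : Set (Fin m × Fin m) := {p | p.1 < p.2}

/-- Finite sequences of elements of `S` in which every element of `S` appears at least once. -/
def pivotSequences {m : ℕ} (S : Set (Fin m × Fin m)) : Set (List (Fin m × Fin m)) :=
  {O | ∀ p, p ∈ O ↔ p ∈ S}

/-- `l = τ(1), τ(2), …` lists a permutation of the set `s`: every element of `s` occurs
exactly once, and nothing else occurs. -/
def IsPermutationOf {m : ℕ} (l : List (Fin m)) (s : Set (Fin m)) : Prop :=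
  l.Nodup ∧ ∀ i, i ∈ l ↔ i ∈ s

/-- Orderings that take the block-columns from the first to the last, the blocks
`(i, j)`, `i < j`, of the `j`-th block-column being taken in an arbitrary order `τ j`. -/
def orderingsC (m : ℕ) : Set (List (Fin m × Fin m)) :=
  {O | O ∈ pivotSequences (pivotPairs m) ∧
    ∃ τ : Fin m → List (Fin m), (∀ j, IsPermutationOf (τ j) (Set.Iio j)) ∧
      O = (List.finRange m).flatMap fun j => (τ j).map fun i => (i, j)}

/-- Orderings that take the block-rows from the last to the first, the blocks
`(i, j)`, `i < j`, of the `i`-th block-row being taken in an arbitrary order `τ i`. -/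
def orderingsR (m : ℕ) : Set (List (Fin m × Fin m)) :=
  {O | O ∈ pivotSequences (pivotPairs m) ∧
    ∃ τ : Fin m → List (Fin m), (∀ i, IsPermutationOf (τ i) (Set.Ioi i)) ∧
      O = (List.finRange m).reverse.flatMap fun i => (τ i).map fun j => (i, j)}

/-- Sequences whose reverse belongs to `B`. -/
def reversed {m : ℕ} (B : Set (List (Fin m × Fin m))) : Set (List (Fin m × Fin m)) :=
  {O | O ∈ pivotSequences (pivotPairs m) ∧ O.reverse ∈ B}

/-- Column-wise orderings with permutations. -/
def orderingsCP (m : ℕ) : Set (List (Fin m × Fin m)) := orderingsC m ∪ reversed (orderingsC m)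

/-- Row-wise orderings with permutations. -/
def orderingsRP (m : ℕ) : Set (List (Fin m × Fin m)) := orderingsR m ∪ reversed (orderingsR m)

/-- Serial orderings with permutations. -/
def orderingsSP (m : ℕ) : Set (List (Fin m × Fin m)) := orderingsCP m ∪ orderingsRP m

/-! ### Block matrices

A partition `π = (n₁, …, n_m)` of `n` into positive parts is a `Composition n`; here
`π.length = m`, `π.blocksFun r` is the size of the `r`-th block, `π.embedding r` embeds its
indices into those of the whole matrix, and `π.index s` is the block that contains `s`. -/

/-- The block `A_{rs}`. -/
def block {n : ℕ} (π : Composition n) (A : Matrix (Fin n) (Fin n) ℝ) (r s : Fin π.length) :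
    Matrix (Fin (π.blocksFun r)) (Fin (π.blocksFun s)) ℝ :=
  A.submatrix (π.embedding r) (π.embedding s)

/-- The row or column index `s` belongs to the `i`-th or to the `j`-th block. -/
def InPivot {n : ℕ} (π : Composition n) (p : Fin π.length × Fin π.length) (s : Fin n) : Prop :=
  π.index s = p.1 ∨ π.index s = p.2

/-- Orthogonal elementary block matrices with pivot pair `p`: orthogonal matrices that differ
from the identity at most in the pivot submatrix. -/
def orthogonalElementary {n : ℕ} (π : Composition n) (p : Fin π.length × Fin π.length) :
    Set (Matrix (Fin n) (Fin n) ℝ) :=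
  {U | U ∈ Matrix.orthogonalGroup (Fin n) ℝ ∧
    ∀ s t, ¬ (InPivot π p s ∧ InPivot π p t) → U s t = (1 : Matrix (Fin n) (Fin n) ℝ) s t}

/-- The smallest singular value of a square matrix of order `d ≥ 1` (Mathlib lists the singular
values in nonincreasing order, starting from the index `0`). -/
noncomputable def sigmaMin {d : ℕ} (X : Matrix (Fin d) (Fin d) ℝ) : ℝ :=
  (Matrix.toEuclideanLin X).singularValues (d - 1)

/-- `3 / √((4^a + 6 b - 1) (b + 1))`. -/
noncomputable def gammaConst (a b : ℕ) : ℝ :=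
  3 / Real.sqrt (((4 : ℝ) ^ a + 6 * (b : ℝ) - 1) * ((b : ℝ) + 1))

/-- The class of uniformly bounded cosine (UBC) orthogonal elementary block matrices with
parameter `ρ` and pivot pair `p`. -/
def ubc {n : ℕ} (π : Composition n) (ρ : ℝ) (p : Fin π.length × Fin π.length) :
    Set (Matrix (Fin n) (Fin n) ℝ) :=
  {U | U ∈ orthogonalElementary π p ∧
    sigmaMin (block π U p.1 p.1) = sigmaMin (block π U p.2 p.2) ∧
    ρ * gammaConst (π.blocksFun p.1) (π.blocksFun p.2) ≤ sigmaMin (block π U p.1 p.1)}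

/-! ### The block Jacobi method -/

/-- One step of the block Jacobi method: `A' = Uᵀ A U` where `U` is an orthogonal elementary
block matrix with pivot pair `p`, and the pivot submatrix of `A'` is diagonal. -/
structure IsStep {n : ℕ} (π : Composition n) (p : Fin π.length × Fin π.length)
    (A U A' : Matrix (Fin n) (Fin n) ℝ) : Prop where
  mem_orthogonalElementary : U ∈ orthogonalElementary π p
  eq_mul : A' = U.transpose * A * U
  diagonal_pivot : ∀ s t, InPivot π p s → InPivot π p t → s ≠ t → A' s t = 0

/-- `X 0, X 1, …, X T`, where `T` is the length of `O`, are the iterates of one sweep of the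
block Jacobi method with pivot sequence `O` and transformation matrices `U 0, …, U (T - 1)`. -/
def IsSweep {n : ℕ} (π : Composition n) (O : List (Fin π.length × Fin π.length))
    (U X : ℕ → Matrix (Fin n) (Fin n) ℝ) : Prop :=
  ∀ (k : ℕ) (hk : k < O.length), IsStep π O[k] (X k) (U k) (X (k + 1))

/-- The off-norm of a symmetric matrix: the Frobenius norm of its strictly upper triangular
part. -/
noncomputable def offNorm {n : ℕ} (A : Matrix (Fin n) (Fin n) ℝ) : ℝ :=
  Real.sqrt (∑ s, ∑ t ∈ Finset.Ioi s, |A s t| ^ 2)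

end BlockJacobi

/-!
The off-diagonal blocks evolve autonomously during a sweep:
one step sets the pivot submatrix to zero and applies a congruence with the orthogonal matrix `U`
(`IsStep.offBlocks_eq`), so for given transformation matrices a sweep acts on the off-diagonal
blocks as a linear map that does not increase the Frobenius norm. The diagonal blocks matter only
at the ends: after a sweep each of them has been in some pivot submatrix and is diagonal
(`IsSweep.diagonal_block`), so that the off-norm of the final matrix is carried by the off-diagonal
blocks alone. It therefore suffices that the linear map has norm less than one, uniformly in the
transformation matrices.

The UBC condition bounds the determinants of the diagonal pivot blocks of `U` away from zero, so the
admissible transformation matrices lie in a compact set (`isCompact_boundedElementary`), and so do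
the pairs of a start matrix on the unit sphere and a matrix reached from it
(`OffSweep.isCompact_setOf`). By compactness it is enough to exclude that the norm is preserved by a
single sweep. If it is, every pivot submatrix is already zero when its turn comes
(`OffSweep.stationaryPath`).

In that case the matrix is zero (`StationaryPath.eq_zero_or_eq_zero`). Consider a column-wise
ordering and the treatment of the block-column `a`, when the off-diagonal blocks among the preceding
indices are already known to be zero. Until the pair `(b, a)` is reached, the pivot block `X_{ab}`
has only been multiplied by transposes of the nonsingular blocks `U_{aa}`, and the fill-in in the
other blocks of the block-column `b` is a multiple of the original `X_{ab}`. As the pivot block is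
zero, so are the original block and the fill-in; hence all off-diagonal blocks among the indices
up to `a` are zero afterwards (`StationaryPath.vanishesOn_of_column`). Row-wise orderings are
column-wise ones after reversing the block indices, and reversed orderings are dealt with by running
the stationary path backwards. The orderings and the partitions are finite in number, which gives
the uniform constants.
-/

open Matrix

namespace BlockJacobi

variable {n : ℕ} {π : Composition n}

/-! ### Orthogonal elementary block matrices -/

theorem transpose_mem_orthogonalElementary {p : Fin π.length × Fin π.length}
    {U : Matrix (Fin n) (Fin n) ℝ} (hU : U ∈ orthogonalElementary π p) :
    Uᵀ ∈ orthogonalElementary π p := by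
  refine ⟨?_, fun s t h => ?_⟩
  · have h := hU.1
    rw [mem_orthogonalGroup_iff] at h
    rw [mem_orthogonalGroup_iff', transpose_transpose, h]
  · rw [transpose_apply, hU.2 t s (fun h' => h h'.symm), one_apply, one_apply]
    simp only [eq_comm]

theorem transpose_mul_self_of_mem {p : Fin π.length × Fin π.length}
    {U : Matrix (Fin n) (Fin n) ℝ} (hU : U ∈ orthogonalElementary π p) : Uᵀ * U = 1 :=
  (mem_orthogonalGroup_iff' (Fin n) ℝ).1 hU.1

theorem mul_transpose_self_of_mem {p : Fin π.length × Fin π.length}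
    {U : Matrix (Fin n) (Fin n) ℝ} (hU : U ∈ orthogonalElementary π p) : U * Uᵀ = 1 :=
  mul_eq_one_comm.1 (transpose_mul_self_of_mem hU)

theorem swap_mem_orthogonalElementary {p : Fin π.length × Fin π.length}
    {U : Matrix (Fin n) (Fin n) ℝ} (hU : U ∈ orthogonalElementary π p) :
    U ∈ orthogonalElementary π p.swap :=
  ⟨hU.1, fun s t h => hU.2 s t fun h' => h ⟨h'.1.symm, h'.2.symm⟩⟩

theorem conj_transpose_conj {p : Fin π.length × Fin π.length}
    {U : Matrix (Fin n) (Fin n) ℝ} (hU : U ∈ orthogonalElementary π p)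
    (X : Matrix (Fin n) (Fin n) ℝ) : Uᵀᵀ * (Uᵀ * X * U) * Uᵀ = X := by
  have h := mul_transpose_self_of_mem hU
  calc Uᵀᵀ * (Uᵀ * X * U) * Uᵀ = (U * Uᵀ) * X * (U * Uᵀ) := by
        simp only [transpose_transpose, Matrix.mul_assoc]
    _ = X := by rw [h, Matrix.one_mul, Matrix.mul_one]

theorem sum_mul_of_not_inPivot {p : Fin π.length × Fin π.length}
    {U : Matrix (Fin n) (Fin n) ℝ} (hU : U ∈ orthogonalElementary π p) {t : Fin n}
    (ht : ¬ InPivot π p t) (y : Fin n → ℝ) : ∑ r, U r t * y r = y t := by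
  have h : ∀ r, U r t = (1 : Matrix (Fin n) (Fin n) ℝ) r t := fun r => hU.2 r t fun h => ht h.2
  simp [h, one_apply]

theorem conj_apply (U X : Matrix (Fin n) (Fin n) ℝ) (s t : Fin n) :
    (Uᵀ * X * U) s t = ∑ r, U r t * ∑ q, U q s * X q r := by
  simp only [mul_apply, transpose_apply]
  exact Finset.sum_congr rfl fun r _ => mul_comm _ _

/-- Outside the pivot columns the congruence by `U` is a multiplication from the left only. -/
theorem conj_apply_of_not_inPivot {p : Fin π.length × Fin π.length}
    {U : Matrix (Fin n) (Fin n) ℝ} (hU : U ∈ orthogonalElementary π p) {t : Fin n}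
    (ht : ¬ InPivot π p t) (X : Matrix (Fin n) (Fin n) ℝ) (s : Fin n) :
    (Uᵀ * X * U) s t = ∑ q, U q s * X q t := by
  rw [conj_apply, sum_mul_of_not_inPivot hU ht fun r => ∑ q, U q s * X q r]

theorem conj_apply_of_not_inPivot_not_inPivot {p : Fin π.length × Fin π.length}
    {U : Matrix (Fin n) (Fin n) ℝ} (hU : U ∈ orthogonalElementary π p) {s t : Fin n}
    (hs : ¬ InPivot π p s) (ht : ¬ InPivot π p t) (X : Matrix (Fin n) (Fin n) ℝ) :
    (Uᵀ * X * U) s t = X s t := by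
  rw [conj_apply_of_not_inPivot hU ht, sum_mul_of_not_inPivot hU hs fun q => X q t]

theorem isSymm_conj {X : Matrix (Fin n) (Fin n) ℝ} (hX : X.IsSymm)
    (U : Matrix (Fin n) (Fin n) ℝ) : (Uᵀ * X * U).IsSymm := by
  rw [Matrix.IsSymm, transpose_mul, transpose_mul, transpose_transpose, hX.eq, Matrix.mul_assoc]

/-- The principal submatrix of `X` composed of the blocks with indices in `S` is zero. -/
def VanishesOn (π : Composition n) (S : Set (Fin π.length)) (X : Matrix (Fin n) (Fin n) ℝ) :
    Prop :=
  ∀ s t, π.index s ∈ S → π.index t ∈ S → X s t = 0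

theorem VanishesOn.mono {S T : Set (Fin π.length)} {X : Matrix (Fin n) (Fin n) ℝ}
    (h : VanishesOn π T X) (hST : S ⊆ T) : VanishesOn π S X :=
  fun s t hs ht => h s t (hST hs) (hST ht)

/-- If `S` contains both pivot indices, the principal submatrix on `S` is transformed by itself. -/
theorem VanishesOn.conj {p : Fin π.length × Fin π.length} {U X : Matrix (Fin n) (Fin n) ℝ}
    (hU : U ∈ orthogonalElementary π p) {S : Set (Fin π.length)} (h₁ : p.1 ∈ S) (h₂ : p.2 ∈ S)
    (hX : VanishesOn π S X) : VanishesOn π S (Uᵀ * X * U) := by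
  have key : ∀ r t, π.index t ∈ S → π.index r ∉ S → U r t = 0 := by
    intro r t ht hr
    have hrt : r ≠ t := by rintro rfl; exact hr ht
    rw [hU.2 r t, one_apply_ne hrt]
    rintro ⟨h | h, -⟩ <;> exact hr (h ▸ by assumption)
  intro s t hs ht
  rw [conj_apply]
  refine Finset.sum_eq_zero fun r _ => ?_
  by_cases hr : π.index r ∈ S
  · rw [Finset.sum_eq_zero, mul_zero]
    intro q _
    by_cases hq : π.index q ∈ S
    · rw [hX q r hq hr, mul_zero]
    · rw [key q s hs hq, zero_mul]
  · rw [key r t ht hr, zero_mul]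

/-- The diagonal blocks of `X` are zero. -/
def HollowBlocks (π : Composition n) (X : Matrix (Fin n) (Fin n) ℝ) : Prop :=
  ∀ s t, π.index s = π.index t → X s t = 0

theorem HollowBlocks.conj {p : Fin π.length × Fin π.length} {U X : Matrix (Fin n) (Fin n) ℝ}
    (hU : U ∈ orthogonalElementary π p) (hp : VanishesOn π {p.1, p.2} X)
    (hX : HollowBlocks π X) : HollowBlocks π (Uᵀ * X * U) := by
  intro s t hst
  by_cases ht : InPivot π p t
  · exact VanishesOn.conj hU (by simp) (by simp) hp s t (hst ▸ ht) ht
  · have hs : ¬ InPivot π p s := fun h => ht (by rw [InPivot, ← hst]; exact h)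
    rw [conj_apply_of_not_inPivot_not_inPivot hU hs ht, hX s t hst]

/-- Orthogonal elementary block matrices whose two diagonal pivot blocks are nonsingular. -/
def regularElementary (π : Composition n) (p : Fin π.length × Fin π.length) :
    Set (Matrix (Fin n) (Fin n) ℝ) :=
  {U | U ∈ orthogonalElementary π p ∧ (block π U p.1 p.1).det ≠ 0 ∧ (block π U p.2 p.2).det ≠ 0}

theorem transpose_mem_regularElementary {p : Fin π.length × Fin π.length}
    {U : Matrix (Fin n) (Fin n) ℝ} (hU : U ∈ regularElementary π p) :
    Uᵀ ∈ regularElementary π p := by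
  have h : ∀ r, block π Uᵀ r r = (block π U r r)ᵀ := fun r => rfl
  exact ⟨transpose_mem_orthogonalElementary hU.1, by rw [h, det_transpose]; exact hU.2.1,
    by rw [h, det_transpose]; exact hU.2.2⟩

theorem swap_mem_regularElementary {p : Fin π.length × Fin π.length}
    {U : Matrix (Fin n) (Fin n) ℝ} (hU : U ∈ regularElementary π p) :
    U ∈ regularElementary π p.swap :=
  ⟨swap_mem_orthogonalElementary hU.1, hU.2.2, hU.2.1⟩

/-- A vector supported on the block `a` is zero if the transpose of the nonsingular block `U_{aa}`
maps it to zero. -/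
theorem eq_zero_of_block_det_ne_zero {U : Matrix (Fin n) (Fin n) ℝ} {a : Fin π.length}
    (hU : (block π U a a).det ≠ 0) {y : Fin n → ℝ} (hy : ∀ q, π.index q ≠ a → y q = 0)
    (h : ∀ u, π.index u = a → ∑ q, U q u * y q = 0) {q : Fin n} (hq : π.index q = a) :
    y q = 0 := by
  have hsum : ∀ u, ∑ i, U (π.embedding a i) u * y (π.embedding a i) = ∑ q, U q u * y q := by
    intro u
    refine Fintype.sum_of_injective (π.embedding a) (π.embedding a).injective _ _ (fun q hq => ?_)
      fun _ => rfl
    rw [hy q fun h => hq (π.mem_range_embedding_iff'.2 h.symm), mul_zero]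
  have h0 : (block π U a a)ᵀ *ᵥ (fun i => y (π.embedding a i)) = 0 := by
    funext i
    simpa [mulVec, dotProduct, block] using
      (hsum (π.embedding a i)).trans (h _ (π.index_embedding a i))
  have h1 := eq_zero_of_mulVec_eq_zero (by rwa [det_transpose]) h0
  obtain ⟨i, rfl⟩ : q ∈ Set.range (π.embedding a) := π.mem_range_embedding_iff'.2 hq.symm
  exact congrFun h1 i

/-! ### Sweeps that meet only zero pivot submatrices -/

/-- `Y` arises from `X` by congruences with regular elementary matrices along the pivot sequence,
every pivot submatrix being already zero when its turn comes. -/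
inductive StationaryPath (π : Composition n) : List (Fin π.length × Fin π.length) →
    Matrix (Fin n) (Fin n) ℝ → Matrix (Fin n) (Fin n) ℝ → Prop
  | nil (X : Matrix (Fin n) (Fin n) ℝ) : StationaryPath π [] X X
  | cons {p : Fin π.length × Fin π.length} {O : List (Fin π.length × Fin π.length)}
      {X Y U : Matrix (Fin n) (Fin n) ℝ} (hU : U ∈ regularElementary π p)
      (hX : VanishesOn π {p.1, p.2} X) (h : StationaryPath π O (Uᵀ * X * U) Y) :
      StationaryPath π (p :: O) X Y

namespace StationaryPath

variable {O O' : List (Fin π.length × Fin π.length)} {X Y Z : Matrix (Fin n) (Fin n) ℝ}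

theorem append (h : StationaryPath π O X Y) (h' : StationaryPath π O' Y Z) :
    StationaryPath π (O ++ O') X Z := by
  induction h with
  | nil => exact h'
  | cons hU hX _ ih => exact cons hU hX (ih h')

theorem exists_of_append (h : StationaryPath π (O ++ O') X Z) :
    ∃ Y, StationaryPath π O X Y ∧ StationaryPath π O' Y Z := by
  induction O generalizing X with
  | nil => exact ⟨X, nil X, h⟩
  | cons p O ih =>
    cases h with
    | cons hU hX h =>
      obtain ⟨Y, h₁, h₂⟩ := ih h
      exact ⟨Y, cons hU hX h₁, h₂⟩

/-- Run backwards, a stationary path is again stationary, as a congruence with an elementary matrix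
keeps the pivot submatrix zero. -/
theorem reverse (h : StationaryPath π O X Y) : StationaryPath π O.reverse Y X := by
  induction h with
  | nil X => exact nil X
  | @cons p O X Y U hU hX _ ih =>
    rw [List.reverse_cons]
    refine ih.append (cons (transpose_mem_regularElementary hU)
      (VanishesOn.conj hU.1 (by simp) (by simp) hX) ?_)
    rw [conj_transpose_conj hU.1]
    exact nil X

/-- Only the unordered pivot pairs matter. -/
theorem map_swap (h : StationaryPath π O X Y) : StationaryPath π (O.map Prod.swap) X Y := by
  induction h with
  | nil X => exact nil X
  | cons hU hX _ ih =>
    exact cons (swap_mem_regularElementary hU)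
      (by rwa [Prod.fst_swap, Prod.snd_swap, Set.pair_comm]) ih

theorem isSymm (h : StationaryPath π O X Y) (hX : X.IsSymm) : Y.IsSymm := by
  induction h with
  | nil => exact hX
  | cons _ _ _ ih => exact ih (isSymm_conj hX _)

theorem hollowBlocks (h : StationaryPath π O X Y) (hX : HollowBlocks π X) :
    HollowBlocks π Y := by
  induction h with
  | nil => exact hX
  | cons hU hp _ ih => exact ih (HollowBlocks.conj hU.1 hp hX)

/-- One block-column, in the middle of its treatment: `P` holds the blocks already paired with
the block `a`, `l` lists those still to come. The block-columns of `l` can be nonzero only in the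
block-row `a`, and in the block-rows of `P` by fill-in that vanishes with the entries in the
block-row `a`. As `U_{aa}` is nonsingular, the entries in the block-row `a` vanish with their
transforms, so a zero pivot block forces the whole block-column to be zero. -/
theorem vanishesOn_of_column {a : Fin π.length} {l : List (Fin π.length)} (hl : l.Nodup)
    (P : Set (Fin π.length)) (hal : a ∉ l) (hP : ∀ b ∈ l, b ∉ P)
    (h : StationaryPath π (l.map fun b => (b, a)) X Y) (hX : X.IsSymm)
    (hR : VanishesOn π {b | b ∈ l} X) (hPa : VanishesOn π (insert a P) X)
    (hfill : ∀ t, π.index t ∈ l → (∀ u, π.index u = a → X u t = 0) →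
      ∀ s, π.index s ∈ P → X s t = 0) :
    VanishesOn π (insert a (P ∪ {b | b ∈ l})) Y := by
  induction l generalizing X P with
  | nil =>
    cases h
    simpa using hPa
  | cons b l ih =>
    obtain ⟨hbl, hl⟩ := List.nodup_cons.1 hl
    have hab : a ≠ b := fun h => hal (h ▸ List.mem_cons_self)
    rw [List.map_cons] at h
    cases h with
    | @cons _ _ _ _ U hU hp h =>
    have hUe := hU.1
    have hset : insert a (insert b P ∪ {c | c ∈ l}) = insert a (P ∪ {c | c ∈ b :: l}) := by
      ext c; simp only [Set.mem_insert_iff, Set.mem_union, Set.mem_ofPred_eq, List.mem_cons]; tauto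
    rw [← hset]
    have hout : ∀ t, π.index t ∈ l → ¬ InPivot π (b, a) t := by
      rintro t ht (h | h)
      · exact hbl (by rwa [h] at ht)
      · exact hal (List.mem_cons_of_mem _ (by rwa [h] at ht))
    -- The zero pivot block forces the whole block-column `b` to vanish.
    have hcol : ∀ s t, π.index s ∈ P → π.index t = b → X s t = 0 := fun s t hs ht =>
      hfill t (by simp [ht]) (fun u hu => hp u t (by simp [hu]) (by simp [ht])) s hs
    refine ih hl (insert b P) (fun h => hal (List.mem_cons_of_mem _ h)) ?_ h (isSymm_conj hX U)
      ?_ ?_ ?_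
    · rintro c hc (rfl | hcP)
      · exact hbl hc
      · exact hP c (List.mem_cons_of_mem _ hc) hcP
    · intro s t hs ht
      rw [conj_apply_of_not_inPivot_not_inPivot hUe (hout s hs) (hout t ht)]
      exact hR s t (List.mem_cons_of_mem _ hs) (List.mem_cons_of_mem _ ht)
    · refine VanishesOn.conj hUe (by simp) (by simp) ?_
      have hsymm : ∀ s t, X s t = X t s := fun s t => hX.apply t s
      rintro s t (hs | hs | hs) (ht | ht | ht)
      · exact hPa s t (by simp [hs]) (by simp [ht])
      · exact hp s t (by simp [hs]) (by simp [ht])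
      · exact hPa s t (by simp [hs]) (by simp [ht])
      · exact hp s t (by simp [hs]) (by simp [ht])
      · exact hp s t (by simp [hs]) (by simp [ht])
      · rw [hsymm]; exact hcol t s ht hs
      · exact hPa s t (by simp [hs]) (by simp [ht])
      · exact hcol s t hs ht
      · exact hPa s t (by simp [hs]) (by simp [ht])
    · intro t ht hzero
      have htp := hout t ht
      have ht' : π.index t ∈ b :: l := List.mem_cons_of_mem _ ht
      have hbt : ∀ q, π.index q = b → X q t = 0 := fun q hq => hR q t (by simp [hq]) ht'
      -- The pivot rows of the new column `t` are combinations of the old entries in block `a`.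
      have hrow : ∀ s, InPivot π (b, a) s →
          (Uᵀ * X * U) s t = ∑ q, U q s * (if π.index q = a then X q t else 0) := by
        intro s hs
        rw [conj_apply_of_not_inPivot hUe htp]
        refine Finset.sum_congr rfl fun q _ => ?_
        split_ifs with hqa
        · rfl
        · by_cases hqb : π.index q = b
          · rw [hbt q hqb]
          · have hq : ¬ InPivot π (b, a) q := by rintro (h | h) <;> contradiction
            have hqs : q ≠ s := by rintro rfl; exact hq hs
            rw [hUe.2 q s fun h => hq h.1, one_apply_ne hqs, zero_mul, zero_mul]
      -- As `U_{aa}` is nonsingular, the old entries in block `a` vanish with the new ones.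
      have hat : ∀ q, π.index q = a → X q t = 0 := by
        intro q hq
        have := eq_zero_of_block_det_ne_zero (U := U) (a := a) hU.2.2
          (y := fun q => if π.index q = a then X q t else 0) (fun q hq => if_neg hq)
          (fun u hu => (hrow u (Or.inr hu)).symm.trans (hzero u hu)) hq
        simpa [hq] using this
      rintro s (hs | hs)
      · rw [hrow s (Or.inl hs)]
        refine Finset.sum_eq_zero fun q _ => ?_
        split_ifs with hq
        · rw [hat q hq, mul_zero]
        · rw [mul_zero]
      · by_cases hsp : InPivot π (b, a) s
        · rw [hrow s hsp]
          refine Finset.sum_eq_zero fun q _ => ?_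
          split_ifs with hq
          · rw [hat q hq, mul_zero]
          · rw [mul_zero]
        · rw [conj_apply_of_not_inPivot_not_inPivot hUe hsp htp]
          exact hfill t ht' hat s hs

/-- Block-columns are cleared one after another, in the order given by `L`. -/
theorem vanishesOn_of_flatMap {L : List (Fin π.length)} (hL : L.Nodup)
    {τ : Fin π.length → List (Fin π.length)}
    (hτ : ∀ L₁ a L₂, L = L₁ ++ a :: L₂ → IsPermutationOf (τ a) {b | b ∈ L₁})
    (h : StationaryPath π (L.flatMap fun a => (τ a).map fun b => (b, a)) X Y)
    (hX : X.IsSymm) (hX₀ : HollowBlocks π X) : VanishesOn π {b | b ∈ L} Y := by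
  induction L using List.reverseRecOn generalizing Y with
  | nil => exact fun s t hs => absurd hs (by simp)
  | append_singleton L a ih =>
    rw [List.flatMap_append] at h
    obtain ⟨Z, h₁, h₂⟩ := h.exists_of_append
    have hL' := List.nodup_append.1 hL
    have haL : a ∉ L := fun h => hL'.2.2 a h a (by simp) rfl
    have hZ := ih hL'.1 (fun L₁ c L₂ e => hτ L₁ c (L₂ ++ [a]) (by simp [e])) h₁
    obtain ⟨hnd, hmem⟩ := hτ L a [] rfl
    have hmem' : {b | b ∈ τ a} = {b | b ∈ L} := Set.ext hmem
    have := vanishesOn_of_column hnd ∅ (fun h => haL ((hmem a).1 h)) (by simp)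
      (by simpa using h₂) (h₁.isSymm hX) (by rwa [hmem'])
      (fun s t hs ht => h₁.hollowBlocks hX₀ s t (by simp_all)) (by simp)
    refine this.mono fun b hb => ?_
    rw [hmem']
    simpa [or_comm] using hb

theorem eq_zero_of_vanishesOn_univ (h : VanishesOn π Set.univ X) : X = 0 :=
  Matrix.ext fun s t => h s t trivial trivial

theorem setOf_mem_eq_of_pairwise {m : ℕ} {r : Fin m → Fin m → Prop} [Std.Asymm r]
    {L L₁ L₂ : List (Fin m)} {a : Fin m} (hr : L.Pairwise r) (hmem : ∀ b, b ∈ L)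
    (hL : L = L₁ ++ a :: L₂) : {b | b ∈ L₁} = {b | r b a} := by
  rw [hL, List.pairwise_append] at hr
  obtain ⟨-, h₂, h₃⟩ := hr
  ext b
  refine ⟨fun hb => h₃ b hb a List.mem_cons_self, fun hb : r b a => ?_⟩
  have hbL := hmem b
  rw [hL, List.mem_append, List.mem_cons] at hbL
  rcases hbL with hb' | rfl | hb'
  · exact hb'
  · exact absurd hb (Std.Asymm.asymm _ _ hb)
  · exact absurd hb (Std.Asymm.asymm _ _ ((List.pairwise_cons.1 h₂).1 b hb'))

theorem eq_zero_of_mem_orderingsC (hO : O ∈ orderingsC π.length)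
    (h : StationaryPath π O X Y) (hX : X.IsSymm) (hX₀ : HollowBlocks π X) : Y = 0 := by
  obtain ⟨-, τ, hτ, rfl⟩ := hO
  refine eq_zero_of_vanishesOn_univ ((vanishesOn_of_flatMap (List.nodup_finRange _)
    (fun L₁ a L₂ e => ?_) h hX hX₀).mono fun b _ => List.mem_finRange b)
  rw [setOf_mem_eq_of_pairwise (List.pairwise_lt_finRange π.length) List.mem_finRange e]
  exact hτ a

/-- Row orderings become column orderings when the block indices are read from the last to the
first. -/
theorem eq_zero_of_mem_orderingsR (hO : O ∈ orderingsR π.length)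
    (h : StationaryPath π O X Y) (hX : X.IsSymm) (hX₀ : HollowBlocks π X) : Y = 0 := by
  obtain ⟨-, τ, hτ, rfl⟩ := hO
  have h' := h.map_swap
  rw [List.map_flatMap] at h'
  have hmem : ∀ b, b ∈ (List.finRange π.length).reverse := fun b =>
    List.mem_reverse.2 (List.mem_finRange b)
  refine eq_zero_of_vanishesOn_univ ((vanishesOn_of_flatMap (τ := τ)
    (List.nodup_reverse.2 (List.nodup_finRange _)) (fun L₁ a L₂ e => ?_)
    (by simpa [Function.comp_def] using h') hX hX₀).mono fun b _ => hmem b)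
  rw [setOf_mem_eq_of_pairwise (List.pairwise_reverse.2 (List.pairwise_lt_finRange π.length))
    hmem e]
  exact hτ a

/-- For a reversed ordering the path is run backwards, so that the start vanishes. -/
theorem eq_zero_or_eq_zero (hO : O ∈ orderingsSP π.length)
    (h : StationaryPath π O X Y) (hX : X.IsSymm) (hX₀ : HollowBlocks π X) : X = 0 ∨ Y = 0 := by
  rcases hO with (hO | hO) | (hO | hO)
  · exact Or.inr (h.eq_zero_of_mem_orderingsC hO hX hX₀)
  · exact Or.inl (h.reverse.eq_zero_of_mem_orderingsC hO.2 (h.isSymm hX) (h.hollowBlocks hX₀))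
  · exact Or.inr (h.eq_zero_of_mem_orderingsR hO hX hX₀)
  · exact Or.inl (h.reverse.eq_zero_of_mem_orderingsR hO.2 (h.isSymm hX) (h.hollowBlocks hX₀))

end StationaryPath

/-! ### The sweep as a nonexpansive linear map -/

/-- The squared Frobenius norm. -/
def normSq (X : Matrix (Fin n) (Fin n) ℝ) : ℝ := ∑ s, ∑ t, X s t ^ 2

theorem normSq_nonneg (X : Matrix (Fin n) (Fin n) ℝ) : 0 ≤ normSq X :=
  Finset.sum_nonneg fun _ _ => Finset.sum_nonneg fun _ _ => sq_nonneg _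

theorem normSq_zero : normSq (0 : Matrix (Fin n) (Fin n) ℝ) = 0 := by simp [normSq]

theorem normSq_smul (c : ℝ) (X : Matrix (Fin n) (Fin n) ℝ) :
    normSq (c • X) = c ^ 2 * normSq X := by
  simp [normSq, mul_pow, Finset.mul_sum]

theorem sq_le_normSq (X : Matrix (Fin n) (Fin n) ℝ) (s t : Fin n) : X s t ^ 2 ≤ normSq X :=
  (Finset.single_le_sum (f := fun t => X s t ^ 2) (fun _ _ => sq_nonneg _)
    (Finset.mem_univ t)).trans
    (Finset.single_le_sum (f := fun s => ∑ t, X s t ^ 2)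
      (fun _ _ => Finset.sum_nonneg fun _ _ => sq_nonneg _) (Finset.mem_univ s))

theorem normSq_eq_trace (X : Matrix (Fin n) (Fin n) ℝ) : normSq X = (Xᵀ * X).trace := by
  simp only [normSq, trace, diag_apply, mul_apply, transpose_apply, ← sq]
  exact Finset.sum_comm

theorem normSq_conj {p : Fin π.length × Fin π.length} {U : Matrix (Fin n) (Fin n) ℝ}
    (hU : U ∈ orthogonalElementary π p) (X : Matrix (Fin n) (Fin n) ℝ) :
    normSq (Uᵀ * X * U) = normSq X := by
  have h := mul_transpose_self_of_mem hU
  rw [normSq_eq_trace, normSq_eq_trace]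
  calc ((Uᵀ * X * U)ᵀ * (Uᵀ * X * U)).trace = (Uᵀ * (Xᵀ * (U * Uᵀ) * X * U)).trace := by
        simp only [transpose_mul, transpose_transpose, Matrix.mul_assoc]
    _ = (Xᵀ * X * (U * Uᵀ)).trace := by
        rw [trace_mul_comm, h, Matrix.mul_one, Matrix.mul_assoc, h]
    _ = (Xᵀ * X).trace := by rw [h, Matrix.mul_one]

open Classical in
/-- `X` with its pivot submatrix replaced by zero. -/
noncomputable def cut (π : Composition n) (p : Fin π.length × Fin π.length)
    (X : Matrix (Fin n) (Fin n) ℝ) : Matrix (Fin n) (Fin n) ℝ :=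
  of fun s t => if InPivot π p s ∧ InPivot π p t then 0 else X s t

theorem vanishesOn_cut (p : Fin π.length × Fin π.length) (X : Matrix (Fin n) (Fin n) ℝ) :
    VanishesOn π {p.1, p.2} (cut π p X) := fun s t hs ht => by
  simp only [cut, of_apply]
  exact if_pos ⟨hs, ht⟩

theorem cut_smul (p : Fin π.length × Fin π.length) (c : ℝ) (X : Matrix (Fin n) (Fin n) ℝ) :
    cut π p (c • X) = c • cut π p X := by
  ext s t
  simp only [cut, of_apply, Matrix.smul_apply, smul_ite, smul_zero]

theorem continuous_cut (p : Fin π.length × Fin π.length) : Continuous (cut π p) := by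
  refine continuous_matrix fun s t => ?_
  by_cases h : InPivot π p s ∧ InPivot π p t
  · simpa only [cut, of_apply, if_pos h] using continuous_const
  · simpa only [cut, of_apply, if_neg h, id] using continuous_id.matrix_elem s t

theorem sq_cut_le (p : Fin π.length × Fin π.length) (X : Matrix (Fin n) (Fin n) ℝ)
    (s t : Fin n) : cut π p X s t ^ 2 ≤ X s t ^ 2 := by
  simp only [cut, of_apply]
  split_ifs
  · simpa using sq_nonneg (X s t)
  · exact le_rfl

theorem normSq_cut_le (p : Fin π.length × Fin π.length) (X : Matrix (Fin n) (Fin n) ℝ) :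
    normSq (cut π p X) ≤ normSq X :=
  Finset.sum_le_sum fun s _ => Finset.sum_le_sum fun t _ => sq_cut_le p X s t

theorem cut_eq_self_of_normSq_eq {p : Fin π.length × Fin π.length}
    {X : Matrix (Fin n) (Fin n) ℝ} (h : normSq (cut π p X) = normSq X) : cut π p X = X := by
  have h₁ := (Finset.sum_eq_sum_iff_of_le fun s _ =>
    Finset.sum_le_sum fun t _ => sq_cut_le p X s t).1 h
  ext s t
  have h₂ := (Finset.sum_eq_sum_iff_of_le fun t _ => sq_cut_le p X s t).1
    (h₁ s (Finset.mem_univ s)) t (Finset.mem_univ t)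
  simp only [cut, of_apply] at h₂ ⊢
  split_ifs at h₂ ⊢
  · exact (pow_eq_zero_iff two_ne_zero |>.1 (by rw [← h₂]; simp)).symm
  · rfl

/-- The effect of a sweep on the matrix `X` of off-diagonal blocks: `Y` arises from `X` by
successively annihilating the pivot submatrix and transforming with a matrix from the class `C`.
On the off-diagonal blocks the sweep is thus linear for given transformation matrices. -/
def OffSweep (π : Composition n)
    (C : Fin π.length × Fin π.length → Set (Matrix (Fin n) (Fin n) ℝ)) :
    List (Fin π.length × Fin π.length) →
      Matrix (Fin n) (Fin n) ℝ → Matrix (Fin n) (Fin n) ℝ → Prop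
  | [], X, Y => Y = X
  | p :: O, X, Y => ∃ U ∈ C p, OffSweep π C O (Uᵀ * cut π p X * U) Y

namespace OffSweep

variable {C : Fin π.length × Fin π.length → Set (Matrix (Fin n) (Fin n) ℝ)}
  {O : List (Fin π.length × Fin π.length)} {X Y : Matrix (Fin n) (Fin n) ℝ}

theorem smul (h : OffSweep π C O X Y) (c : ℝ) : OffSweep π C O (c • X) (c • Y) := by
  induction O generalizing X with
  | nil => exact congrArg (c • ·) h
  | cons p O ih =>
    obtain ⟨U, hU, h⟩ := h
    refine ⟨U, hU, ?_⟩
    simpa [cut_smul] using ih h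

theorem normSq_le (hC : ∀ p, C p ⊆ orthogonalElementary π p) (h : OffSweep π C O X Y) :
    normSq Y ≤ normSq X := by
  induction O generalizing X with
  | nil => rw [show Y = X from h]
  | cons p O ih =>
    obtain ⟨U, hU, h⟩ := h
    exact (ih h).trans ((normSq_conj (hC p hU) _).le.trans (normSq_cut_le p X))

/-- The norm drops in a step exactly when the pivot submatrix is nonzero. -/
theorem stationaryPath (hC : ∀ p, C p ⊆ regularElementary π p) (h : OffSweep π C O X Y)
    (hXY : normSq Y = normSq X) : StationaryPath π O X Y := by
  induction O generalizing X with
  | nil => rw [show Y = X from h]; exact .nil X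
  | cons p O ih =>
    obtain ⟨U, hU, h⟩ := h
    have h₁ := h.normSq_le fun p => (hC p).trans fun _ hU => hU.1
    have h₂ := normSq_conj (hC p hU).1 (cut π p X)
    have h₃ := normSq_cut_le p X
    have hcut : cut π p X = X := cut_eq_self_of_normSq_eq (by linarith)
    refine .cons (hC p hU) (hcut ▸ vanishesOn_cut p X) ?_
    have := ih h (by linarith)
    rwa [hcut] at this

/-- The pairs of a start matrix and a matrix reached by the sweep form a compact set. -/
theorem isCompact_setOf (hC : ∀ p, IsCompact (C p)) (O : List (Fin π.length × Fin π.length))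
    {S : Set (Matrix (Fin n) (Fin n) ℝ × Matrix (Fin n) (Fin n) ℝ)} (hS : IsCompact S) :
    IsCompact {z : Matrix (Fin n) (Fin n) ℝ × Matrix (Fin n) (Fin n) ℝ |
      ∃ X, (z.1, X) ∈ S ∧ OffSweep π C O X z.2} := by
  induction O generalizing S with
  | nil =>
    convert hS using 1
    ext ⟨X₀, Y⟩
    constructor
    · rintro ⟨X, hX, h⟩
      rw [show Y = X from h]
      exact hX
    · exact fun h => ⟨Y, h, rfl⟩
  | cons p O ih =>
    have hcont : Continuous fun w : (Matrix (Fin n) (Fin n) ℝ × Matrix (Fin n) (Fin n) ℝ) ×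
        Matrix (Fin n) (Fin n) ℝ => (w.1.1, w.2ᵀ * cut π p w.1.2 * w.2) := by
      have := (continuous_cut (π := π) p).comp (continuous_snd.comp
        (continuous_fst (X := Matrix (Fin n) (Fin n) ℝ × Matrix (Fin n) (Fin n) ℝ)
          (Y := Matrix (Fin n) (Fin n) ℝ)))
      exact (continuous_fst.comp continuous_fst).prodMk
        ((continuous_snd.matrix_transpose.matrix_mul this).matrix_mul continuous_snd)
    convert ih ((hS.prod (hC p)).image hcont) using 1
    ext ⟨X₀, Y⟩
    constructor
    · rintro ⟨X, hX, U, hU, h⟩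
      exact ⟨_, ⟨((X₀, X), U), ⟨hX, hU⟩, rfl⟩, h⟩
    · rintro ⟨_, ⟨⟨⟨X₁, X⟩, U⟩, ⟨hX, hU⟩, e⟩, h⟩
      obtain ⟨rfl, rfl⟩ := Prod.mk.inj e
      exact ⟨X, hX, U, hU, h⟩

end OffSweep

theorem continuous_normSq : Continuous (normSq (n := n)) :=
  continuous_finsetSum _ fun s _ => continuous_finsetSum _ fun t _ =>
    (continuous_id.matrix_elem s t).pow 2

theorem isCompact_of_isClosed_of_abs_le {K : Set (Matrix (Fin n) (Fin n) ℝ)} (hK : IsClosed K)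
    (h : ∀ X ∈ K, ∀ s t, |X s t| ≤ 1) : IsCompact K := by
  have hc : IsCompact (Set.univ.pi fun _ : Fin n => Set.univ.pi fun _ : Fin n =>
      Set.Icc (-1 : ℝ) 1) :=
    isCompact_univ_pi fun _ => isCompact_univ_pi fun _ => isCompact_Icc
  exact hc.of_isClosed_subset hK fun X hX s _ t _ => abs_le.1 (h X hX s t)

/-- The symmetric matrices of norm one with zero diagonal blocks. -/
def hollowSphere (π : Composition n) : Set (Matrix (Fin n) (Fin n) ℝ) :=
  {X | X.IsSymm ∧ HollowBlocks π X ∧ normSq X = 1}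

theorem isCompact_hollowSphere (π : Composition n) : IsCompact (hollowSphere π) := by
  refine isCompact_of_isClosed_of_abs_le ?_ fun X hX s t => ?_
  · have h₁ : IsClosed {X : Matrix (Fin n) (Fin n) ℝ | X.IsSymm} :=
      isClosed_eq continuous_id.matrix_transpose continuous_id
    have h₂ : IsClosed {X : Matrix (Fin n) (Fin n) ℝ | HollowBlocks π X} := by
      simp only [HollowBlocks, Set.ofPred_forall]
      exact isClosed_iInter fun s => isClosed_iInter fun t => isClosed_iInter fun _ =>
        isClosed_eq (continuous_id.matrix_elem s t) continuous_const
    exact h₁.inter (h₂.inter (isClosed_eq continuous_normSq continuous_const))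
  · exact (sq_le_one_iff_abs_le_one _).1 (hX.2.2 ▸ sq_le_normSq X s t)

/-- For a fixed ordering the sweep contracts the off-diagonal blocks, uniformly over a compact
class of regular transformation matrices. -/
theorem exists_offSweep_contraction
    {C : Fin π.length × Fin π.length → Set (Matrix (Fin n) (Fin n) ℝ)}
    (hC : ∀ p, IsCompact (C p)) (hreg : ∀ p, C p ⊆ regularElementary π p)
    {O : List (Fin π.length × Fin π.length)} (hO : O ∈ orderingsSP π.length) :
    ∃ η : ℝ, 0 ≤ η ∧ η < 1 ∧ ∀ X Y : Matrix (Fin n) (Fin n) ℝ, X.IsSymm → HollowBlocks π X →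
      OffSweep π C O X Y → normSq Y ≤ η * normSq X := by
  have hel : ∀ p, C p ⊆ orthogonalElementary π p := fun p => (hreg p).trans fun _ hU => hU.1
  have hK := OffSweep.isCompact_setOf hC O
    ((isCompact_hollowSphere π).image (continuous_id.prodMk continuous_id))
  set K := {z : Matrix (Fin n) (Fin n) ℝ × Matrix (Fin n) (Fin n) ℝ |
    ∃ X, (z.1, X) ∈ (fun X => (id X, id X)) '' hollowSphere π ∧ OffSweep π C O X z.2}
  have hmem : ∀ X Y, (X, Y) ∈ K ↔ X ∈ hollowSphere π ∧ OffSweep π C O X Y := by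
    intro X Y
    constructor
    · rintro ⟨_, ⟨Z, hZ, e⟩, h⟩
      obtain ⟨rfl, rfl⟩ := Prod.mk.inj e
      exact ⟨hZ, h⟩
    · exact fun h => ⟨X, ⟨X, h.1, rfl⟩, h.2⟩
  obtain ⟨η, hη₀, hη₁, hη⟩ : ∃ η : ℝ, 0 ≤ η ∧ η < 1 ∧ ∀ z ∈ K, normSq z.2 ≤ η := by
    rcases K.eq_empty_or_nonempty with hemp | hne
    · exact ⟨0, le_rfl, one_pos, by simp [hemp]⟩
    · obtain ⟨⟨X, Y⟩, hz, hmax⟩ :=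
        hK.exists_isMaxOn hne (continuous_normSq.comp continuous_snd).continuousOn
      refine ⟨normSq Y, normSq_nonneg Y, ?_, fun z hz => hmax hz⟩
      obtain ⟨⟨hX, hX₀, hX₁⟩, h⟩ := (hmem X Y).1 hz
      refine lt_of_le_of_ne (hX₁ ▸ h.normSq_le hel) fun hY => ?_
      have hpath := h.stationaryPath hreg (hY.trans hX₁.symm)
      rcases hpath.eq_zero_or_eq_zero hO hX hX₀ with rfl | rfl
      · exact zero_ne_one (normSq_zero.symm.trans hX₁)
      · exact zero_ne_one (normSq_zero.symm.trans hY)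
  refine ⟨η, hη₀, hη₁, fun X Y hX hX₀ h => ?_⟩
  -- The bound on the unit sphere extends to every `X` since the sweep is homogeneous in `X`.
  rcases (normSq_nonneg X).eq_or_lt with h0 | hpos
  · rw [← h0, mul_zero, h0]
    exact h.normSq_le hel
  · have hsq : ((√(normSq X))⁻¹) ^ 2 = (normSq X)⁻¹ := by rw [inv_pow, Real.sq_sqrt hpos.le]
    have := hη (_, _) ((hmem _ _).2 ⟨⟨hX.smul _, fun s t hst => by simp [hX₀ s t hst], by
      rw [normSq_smul, hsq, inv_mul_cancel₀ hpos.ne']⟩, h.smul (√(normSq X))⁻¹⟩)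
    rw [normSq_smul, hsq, inv_mul_le_iff₀ hpos] at this
    linarith

/-! ### Uniformly bounded cosine matrices -/

/-- The absolute value of the determinant is the product of the singular values. -/
theorem sigmaMin_pow_le_abs_det {d : ℕ} (X : Matrix (Fin d) (Fin d) ℝ) :
    sigmaMin X ^ d ≤ |X.det| := by
  have h : |X.det| = (toEuclideanLin X).normDet := by
    rw [LinearMap.normDet_eq_abs_det]
    change |X.det| = |LinearMap.det (toLpLin 2 2 X)|
    rw [toLpLin_eq_toLin, LinearMap.det_toLin]
  rw [h, LinearMap.normDet_eq_prod_singularValues, finrank_euclideanSpace_fin]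
  calc sigmaMin X ^ d = ∏ _i ∈ Finset.range d, sigmaMin X := by simp
    _ ≤ _ := Finset.prod_le_prod (fun _ _ => LinearMap.singularValues_nonneg _ _) fun i hi =>
      LinearMap.singularValues_antitone _ (Nat.le_sub_one_of_lt (Finset.mem_range.1 hi))

theorem gammaConst_pos {a b : ℕ} (ha : 1 ≤ a) : 0 < gammaConst a b := by
  have h : (4 : ℝ) ≤ 4 ^ a := by simpa using pow_le_pow_right₀ (by norm_num : (1 : ℝ) ≤ 4) ha
  refine div_pos (by norm_num) (Real.sqrt_pos.2 (mul_pos ?_ (by positivity)))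
  have : (0 : ℝ) ≤ b := b.cast_nonneg
  linarith

/-- Orthogonal elementary block matrices whose diagonal pivot blocks have determinants bounded
away from zero. The bounds are those which the lower bound on the singular values in the UBC class
gives; unlike the latter, the determinant is visibly continuous. -/
def boundedElementary (π : Composition n) (ρ : ℝ) (p : Fin π.length × Fin π.length) :
    Set (Matrix (Fin n) (Fin n) ℝ) :=
  {U | U ∈ orthogonalElementary π p ∧
    (ρ * gammaConst (π.blocksFun p.1) (π.blocksFun p.2)) ^ π.blocksFun p.1 ≤
      |(block π U p.1 p.1).det| ∧
    (ρ * gammaConst (π.blocksFun p.1) (π.blocksFun p.2)) ^ π.blocksFun p.2 ≤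
      |(block π U p.2 p.2).det|}

theorem gamma_pos_of_pos {ρ : ℝ} (hρ : 0 < ρ) (p : Fin π.length × Fin π.length) :
    0 < ρ * gammaConst (π.blocksFun p.1) (π.blocksFun p.2) :=
  mul_pos hρ (gammaConst_pos (π.one_le_blocksFun p.1))

theorem ubc_subset_boundedElementary {ρ : ℝ} (hρ : 0 < ρ) (p : Fin π.length × Fin π.length) :
    ubc π ρ p ⊆ boundedElementary π ρ p := by
  rintro U ⟨hU, heq, hle⟩
  have h := (gamma_pos_of_pos hρ p).le
  exact ⟨hU, (pow_le_pow_left₀ h hle _).trans (sigmaMin_pow_le_abs_det _),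
    (pow_le_pow_left₀ h (hle.trans_eq heq) _).trans (sigmaMin_pow_le_abs_det _)⟩

theorem boundedElementary_subset_regularElementary {ρ : ℝ} (hρ : 0 < ρ)
    (p : Fin π.length × Fin π.length) : boundedElementary π ρ p ⊆ regularElementary π p :=
  fun _ hU => ⟨hU.1, abs_pos.1 ((pow_pos (gamma_pos_of_pos hρ p) _).trans_le hU.2.1),
    abs_pos.1 ((pow_pos (gamma_pos_of_pos hρ p) _).trans_le hU.2.2)⟩

theorem isCompact_boundedElementary (ρ : ℝ) (p : Fin π.length × Fin π.length) :
    IsCompact (boundedElementary π ρ p) := by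
  have hdet : ∀ r, Continuous fun U : Matrix (Fin n) (Fin n) ℝ => |(block π U r r).det| :=
    fun r => (Continuous.matrix_submatrix continuous_id _ _).matrix_det.abs
  refine isCompact_of_isClosed_of_abs_le ?_ fun U hU s t =>
    entry_norm_bound_of_unitary (𝕜 := ℝ) hU.1.1 s t
  have h₁ : IsClosed {U : Matrix (Fin n) (Fin n) ℝ | U ∈ orthogonalGroup (Fin n) ℝ} := by
    simp only [mem_orthogonalGroup_iff]
    exact isClosed_eq (continuous_id.matrix_mul continuous_id.matrix_transpose) continuous_const
  have h₂ : IsClosed {U : Matrix (Fin n) (Fin n) ℝ | ∀ s t, ¬ (InPivot π p s ∧ InPivot π p t) →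
      U s t = (1 : Matrix (Fin n) (Fin n) ℝ) s t} := by
    simp only [Set.ofPred_forall]
    exact isClosed_iInter fun s => isClosed_iInter fun t => isClosed_iInter fun _ =>
      isClosed_eq (continuous_id.matrix_elem s t) continuous_const
  exact (h₁.inter h₂).inter ((isClosed_le continuous_const (hdet _)).inter
    (isClosed_le continuous_const (hdet _)))

/-! ### From the iterates to their off-diagonal blocks -/

/-- `A` with its diagonal blocks replaced by zero. -/
def offBlocks (π : Composition n) (A : Matrix (Fin n) (Fin n) ℝ) : Matrix (Fin n) (Fin n) ℝ :=
  of fun s t => if π.index s = π.index t then 0 else A s t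

theorem hollowBlocks_offBlocks (A : Matrix (Fin n) (Fin n) ℝ) :
    HollowBlocks π (offBlocks π A) := fun _ _ h => if_pos h

theorem isSymm_offBlocks {A : Matrix (Fin n) (Fin n) ℝ} (hA : A.IsSymm) :
    (offBlocks π A).IsSymm := by
  ext s t
  simp only [offBlocks, transpose_apply, of_apply, hA.apply s t, eq_comm]

theorem IsStep.isSymm {p : Fin π.length × Fin π.length} {A U A' : Matrix (Fin n) (Fin n) ℝ}
    (h : IsStep π p A U A') (hA : A.IsSymm) : A'.IsSymm :=
  h.eq_mul ▸ isSymm_conj hA U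

/-- The off-diagonal blocks after a step depend only on those before it: the pivot submatrix is
annihilated, and the diagonal blocks do not enter elsewhere. -/
theorem IsStep.offBlocks_eq {p : Fin π.length × Fin π.length}
    {A U A' : Matrix (Fin n) (Fin n) ℝ} (h : IsStep π p A U A') (hA : A.IsSymm) :
    offBlocks π A' = Uᵀ * cut π p (offBlocks π A) * U := by
  have hU := h.mem_orthogonalElementary
  have hcutsymm : (cut π p (offBlocks π A)).IsSymm := by
    ext s t
    have := (isSymm_offBlocks (π := π) hA).apply s t
    simp only [cut, transpose_apply, of_apply, this]
    split_ifs <;> tauto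
  -- By symmetry it suffices, outside the pivot submatrix, to treat the columns `t` not in it.
  have hcol : ∀ s t, ¬ InPivot π p t →
      offBlocks π A' s t = (Uᵀ * cut π p (offBlocks π A) * U) s t := by
    intro s t ht
    rw [conj_apply_of_not_inPivot hU ht]
    have hcut : ∀ q, cut π p (offBlocks π A) q t = offBlocks π A q t := fun q => by
      simp [cut, ht]
    simp only [hcut]
    by_cases hs : InPivot π p s
    · have hst : π.index s ≠ π.index t := fun e => ht (by rw [InPivot, ← e]; exact hs)
      simp only [offBlocks, of_apply, if_neg hst]
      rw [h.eq_mul, conj_apply_of_not_inPivot hU ht]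
      refine Finset.sum_congr rfl fun q _ => ?_
      split_ifs with hqt
      · have hq : ¬ InPivot π p q := by rwa [InPivot, hqt]
        rw [hU.2 q s fun h => hq h.1, one_apply_ne (by rintro rfl; exact hq hs), zero_mul, zero_mul]
      · rfl
    · rw [sum_mul_of_not_inPivot hU hs fun q => offBlocks π A q t]
      simp only [offBlocks, of_apply]
      rw [h.eq_mul, conj_apply_of_not_inPivot_not_inPivot hU hs ht]
  ext s t
  by_cases ht : InPivot π p t
  · by_cases hs : InPivot π p s
    · rw [VanishesOn.conj hU (by simp) (by simp) (vanishesOn_cut p _) s t hs ht]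
      simp only [offBlocks, of_apply]
      split_ifs with hst
      · rfl
      · exact h.diagonal_pivot s t hs ht fun e => hst (congrArg _ e)
    · rw [← (isSymm_offBlocks (π := π) (h.isSymm hA)).apply, hcol t s hs,
        (isSymm_conj hcutsymm U).apply]
  · exact hcol s t ht

theorem IsSweep.tail {p : Fin π.length × Fin π.length} {O : List (Fin π.length × Fin π.length)}
    {U X : ℕ → Matrix (Fin n) (Fin n) ℝ} (h : IsSweep π (p :: O) U X) :
    IsSweep π O (fun k => U (k + 1)) (fun k => X (k + 1)) :=
  fun k hk => h (k + 1) (Nat.succ_lt_succ hk)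

theorem IsSweep.isSymm {O : List (Fin π.length × Fin π.length)}
    {U X : ℕ → Matrix (Fin n) (Fin n) ℝ} (h : IsSweep π O U X) (hX : (X 0).IsSymm) :
    (X O.length).IsSymm := by
  induction O generalizing U X with
  | nil => exact hX
  | cons p O ih => exact ih h.tail ((h 0 (Nat.succ_pos _)).isSymm hX)

theorem IsSweep.offSweep {C : Fin π.length × Fin π.length → Set (Matrix (Fin n) (Fin n) ℝ)}
    {O : List (Fin π.length × Fin π.length)} {U X : ℕ → Matrix (Fin n) (Fin n) ℝ}
    (h : IsSweep π O U X) (hX : (X 0).IsSymm)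
    (hU : ∀ (k : ℕ) (hk : k < O.length), U k ∈ C O[k]) :
    OffSweep π C O (offBlocks π (X 0)) (offBlocks π (X O.length)) := by
  induction O generalizing U X with
  | nil => rfl
  | cons p O ih =>
    have h₀ := h 0 (Nat.succ_pos _)
    refine ⟨U 0, hU 0 (Nat.succ_pos _), ?_⟩
    have := ih h.tail (h₀.isSymm hX) fun k hk => hU (k + 1) (Nat.succ_lt_succ hk)
    rwa [h₀.offBlocks_eq hX] at this

/-- A diagonal block becomes diagonal when it is first part of a pivot submatrix, and stays so. -/
theorem IsSweep.diagonal_block {O : List (Fin π.length × Fin π.length)}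
    {U X : ℕ → Matrix (Fin n) (Fin n) ℝ} (h : IsSweep π O U X) {r : Fin π.length}
    (hr : (∃ p ∈ O, r = p.1 ∨ r = p.2) ∨
      ∀ s t, π.index s = r → π.index t = r → s ≠ t → X 0 s t = 0)
    {s t : Fin n} (hs : π.index s = r) (ht : π.index t = r) (hst : s ≠ t) :
    X O.length s t = 0 := by
  induction O generalizing U X with
  | nil =>
    rcases hr with ⟨p, hp, -⟩ | hr
    · simp at hp
    · exact hr s t hs ht hst
  | cons p O ih =>
    have h₀ : IsStep π p (X 0) (U 0) (X 1) := h 0 (Nat.succ_pos _)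
    refine ih h.tail ?_
    by_cases hrp : r = p.1 ∨ r = p.2
    · exact Or.inr fun s t hs ht =>
        h₀.diagonal_pivot s t (by rwa [InPivot, hs]) (by rwa [InPivot, ht])
    · rcases hr with ⟨q, hq, hrq⟩ | hr
      · rcases List.mem_cons.1 hq with rfl | hq
        · contradiction
        · exact Or.inl ⟨q, hq, hrq⟩
      · refine Or.inr fun s t hs ht hst => ?_
        change X 1 s t = 0
        rw [h₀.eq_mul, conj_apply_of_not_inPivot_not_inPivot h₀.mem_orthogonalElementary
          (by rwa [InPivot, hs]) (by rwa [InPivot, ht]), hr s t hs ht hst]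

theorem sum_sum_eq_two_mul_sum_Ioi {f : Fin n → Fin n → ℝ} (hf : ∀ s t, f s t = f t s)
    (hf₀ : ∀ s, f s s = 0) : ∑ s, ∑ t, f s t = 2 * ∑ s, ∑ t ∈ Finset.Ioi s, f s t := by
  have h : ∀ s, ∑ t, f s t = ∑ t ∈ Finset.Iio s, f s t + ∑ t ∈ Finset.Ioi s, f s t := by
    intro s
    rw [← Finset.sum_union (Finset.disjoint_left.2 fun t h₁ h₂ =>
      lt_asymm (Finset.mem_Iio.1 h₁) (Finset.mem_Ioi.1 h₂))]
    refine (Finset.sum_subset (Finset.subset_univ _) fun t _ ht => ?_).symm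
    simp only [Finset.mem_union, Finset.mem_Iio, Finset.mem_Ioi, not_or, not_lt] at ht
    rw [le_antisymm ht.1 ht.2] at *
    exact hf₀ _
  have hcomm : ∑ s, ∑ t ∈ Finset.Iio s, f s t = ∑ s, ∑ t ∈ Finset.Ioi s, f s t := by
    rw [Finset.sum_comm' (t' := Finset.univ) (s' := fun t => Finset.Ioi t) (by simp)]
    exact Finset.sum_congr rfl fun s _ => Finset.sum_congr rfl fun t _ => hf t s
  rw [Finset.sum_congr rfl fun s _ => h s, Finset.sum_add_distrib, hcomm, two_mul]

theorem offNorm_sq (A : Matrix (Fin n) (Fin n) ℝ) :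
    offNorm A ^ 2 = ∑ s, ∑ t ∈ Finset.Ioi s, A s t ^ 2 := by
  rw [offNorm, Real.sq_sqrt (by positivity)]
  simp

theorem normSq_offBlocks {A : Matrix (Fin n) (Fin n) ℝ} (hA : A.IsSymm) :
    normSq (offBlocks π A) = 2 * ∑ s, ∑ t ∈ Finset.Ioi s, offBlocks π A s t ^ 2 :=
  sum_sum_eq_two_mul_sum_Ioi (fun s t => by rw [(isSymm_offBlocks hA).apply]) fun s => by
    simp [offBlocks]

theorem normSq_offBlocks_le {A : Matrix (Fin n) (Fin n) ℝ} (hA : A.IsSymm) :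
    normSq (offBlocks π A) ≤ 2 * offNorm A ^ 2 := by
  rw [normSq_offBlocks hA, offNorm_sq]
  refine mul_le_mul_of_nonneg_left (Finset.sum_le_sum fun s _ => Finset.sum_le_sum fun t _ => ?_)
    zero_le_two
  simp only [offBlocks, of_apply]
  split_ifs
  · simpa using sq_nonneg (A s t)
  · exact le_rfl

/-- When the diagonal blocks are diagonal, the off-diagonal blocks carry the whole off-norm. -/
theorem normSq_offBlocks_eq {A : Matrix (Fin n) (Fin n) ℝ} (hA : A.IsSymm)
    (hdiag : ∀ s t, π.index s = π.index t → s ≠ t → A s t = 0) :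
    normSq (offBlocks π A) = 2 * offNorm A ^ 2 := by
  rw [normSq_offBlocks hA, offNorm_sq]
  refine congrArg (2 * ·) (Finset.sum_congr rfl fun s _ => Finset.sum_congr rfl fun t ht => ?_)
  simp only [offBlocks, of_apply]
  split_ifs with hst
  · rw [hdiag s t hst (Finset.mem_Ioi.1 ht).ne]
  · rfl

/-! ### The class of orderings -/

theorem mem_pivotSequences_of_mem_orderingsSP {m : ℕ} {O : List (Fin m × Fin m)}
    (hO : O ∈ orderingsSP m) : O ∈ pivotSequences (pivotPairs m) := by
  rcases hO with (hO | hO) | (hO | hO) <;> exact hO.1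

theorem exists_mem_of_mem_orderingsSP {m : ℕ} (hm : 2 ≤ m) {O : List (Fin m × Fin m)}
    (hO : O ∈ orderingsSP m) (r : Fin m) : ∃ p ∈ O, r = p.1 ∨ r = p.2 := by
  have hmem := mem_pivotSequences_of_mem_orderingsSP hO
  have : Nontrivial (Fin m) := Fin.nontrivial_iff_two_le.2 hm
  obtain ⟨r', hr'⟩ := exists_ne r
  rcases lt_or_gt_of_ne hr' with h | h
  · exact ⟨(r', r), (hmem _).2 h, Or.inr rfl⟩
  · exact ⟨(r, r'), (hmem _).2 h, Or.inl rfl⟩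

theorem finite_orderingsSP (m : ℕ) : (orderingsSP m).Finite := by
  have hrev : ∀ B : Set (List (Fin m × Fin m)), B.Finite → (reversed B).Finite := fun B hB =>
    (hB.preimage List.reverse_injective.injOn).subset fun _ hO => hO.2
  have hC : (orderingsC m).Finite := by
    refine (Set.finite_range fun τ : Fin m → {l : List (Fin m) // l.Nodup} =>
      (List.finRange m).flatMap fun j => (τ j).1.map fun i => (i, j)).subset ?_
    rintro O ⟨-, τ, hτ, rfl⟩
    exact ⟨fun j => ⟨τ j, (hτ j).1⟩, rfl⟩
  have hR : (orderingsR m).Finite := by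
    refine (Set.finite_range fun τ : Fin m → {l : List (Fin m) // l.Nodup} =>
      (List.finRange m).reverse.flatMap fun i => (τ i).1.map fun j => (i, j)).subset ?_
    rintro O ⟨-, τ, hτ, rfl⟩
    exact ⟨fun j => ⟨τ j, (hτ j).1⟩, rfl⟩
  exact (hC.union (hrev _ hC)).union (hR.union (hrev _ hR))

/-- A finite family of numbers in `[0, 1)` has an upper bound in `[0, 1)`. -/
theorem exists_uniform_lt_one {ι : Type*} {S : Set ι} (hS : S.Finite) {η : ι → ℝ}
    (hη : ∀ i ∈ S, η i < 1) : ∃ c : ℝ, 0 ≤ c ∧ c < 1 ∧ ∀ i ∈ S, η i ≤ c := by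
  induction S, hS using Set.Finite.induction_on with
  | empty => exact ⟨0, le_rfl, one_pos, by simp⟩
  | @insert a S _ _ ih =>
    obtain ⟨c, hc₀, hc₁, hc⟩ := ih fun i hi => hη i (Set.mem_insert_of_mem a hi)
    refine ⟨max c (η a), le_max_of_le_left hc₀, max_lt hc₁ (hη a (Set.mem_insert a S)), ?_⟩
    rintro i (rfl | hi)
    · exact le_max_right _ _
    · exact (hc i hi).trans (le_max_left _ _)

/-- The contraction for one partition, uniform in the ordering. -/
theorem exists_sweep_contraction {ρ : ℝ} (hρ : 0 < ρ) (π : Composition n) (hπ : 2 ≤ π.length) :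
    ∃ η : ℝ, 0 ≤ η ∧ η < 1 ∧ ∀ O ∈ orderingsSP π.length,
      ∀ U X : ℕ → Matrix (Fin n) (Fin n) ℝ, (X 0).IsSymm → IsSweep π O U X →
        (∀ (k : ℕ) (hk : k < O.length), U k ∈ ubc π ρ O[k]) →
          offNorm (X O.length) ^ 2 ≤ η * offNorm (X 0) ^ 2 := by
  choose! η hη₀ hη₁ hη using fun O (hO : O ∈ orderingsSP π.length) =>
    exists_offSweep_contraction (isCompact_boundedElementary ρ)
      (boundedElementary_subset_regularElementary hρ) hO
  obtain ⟨c, hc₀, hc₁, hc⟩ := exists_uniform_lt_one (finite_orderingsSP π.length) hη₁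
  refine ⟨c, hc₀, hc₁, fun O hO U X hX h hU => ?_⟩
  have h₁ := hη O hO _ _ (isSymm_offBlocks hX) (hollowBlocks_offBlocks _)
    (h.offSweep hX fun k hk => ubc_subset_boundedElementary hρ _ (hU k hk))
  rw [normSq_offBlocks_eq (h.isSymm hX) fun s t hst hne =>
    h.diagonal_block (Or.inl (exists_mem_of_mem_orderingsSP hπ hO _)) hst rfl hne] at h₁
  have h₂ : η O * normSq (offBlocks π (X 0)) ≤ c * (2 * offNorm (X 0) ^ 2) :=
    mul_le_mul (hc O hO) (normSq_offBlocks_le hX) (normSq_nonneg _) hc₀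
  linarith

end BlockJacobi

theorem mainTheorem3 (n : ℕ) (ρ : ℝ) (hρ_pos : 0 < ρ) (hρ_le : ρ ≤ 1) :
    ∃ etaTilde : ℝ, etaTilde < 1 ∧
      ∀ π : Composition n, 2 ≤ π.length →
        ∃ eta : ℝ, 0 ≤ eta ∧ eta < etaTilde ∧
          ∀ O ∈ BlockJacobi.orderingsSP π.length,
            ∀ A A' : Matrix (Fin n) (Fin n) ℝ, A.IsSymm →
              ∀ U X : ℕ → Matrix (Fin n) (Fin n) ℝ,
                BlockJacobi.IsSweep π O U X → X 0 = A → X O.length = A' →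
                (∀ (k : ℕ) (hk : k < O.length), U k ∈ BlockJacobi.ubc π ρ O[k]) →
                  BlockJacobi.offNorm A' ^ 2 ≤ eta * BlockJacobi.offNorm A ^ 2 := by
  choose! η hη₀ hη₁ hη using
    fun (π : Composition n) (hπ : 2 ≤ π.length) => BlockJacobi.exists_sweep_contraction hρ_pos π hπ
  obtain ⟨c, -, hc₁, hc⟩ :=
    BlockJacobi.exists_uniform_lt_one (Set.toFinite {π : Composition n | 2 ≤ π.length}) hη₁
  -- `c` bounds the contraction constants of the finitely many partitions; the midpoint of `c` and
  -- `1` is strictly above them.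
  refine ⟨(c + 1) / 2, by linarith, fun π hπ => ⟨η π, hη₀ π hπ, ?_, ?_⟩⟩
  · have := hc π hπ
    linarith
  · rintro O hO A A' hA U X h rfl rfl hU
    exact hη π hπ O hO U X hA h hU
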